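/- Let $m\ge 2$, $q=2^m$ and $u=2^{m-1}$. Let $\alpha$ be a primitive element of $\mathrm{GF}(q^2)$ (a generator of its multiplicative group) and put $\beta=\alpha^{q-1}$, a primitive $(q+1)$-th root of unity. Let $\mathbb{M}_{\beta^i}(x)$ be the minimal polynomial of $\beta^i$ over $\mathrm{GF}(q)$, let $g_u(x)=\prod_{i=u}^{\lfloor (q+1)/2\rfloor}\mathbb{M}_{\beta^i}(x)$ (here just $\mathbb{M}_{\beta^u}(x)$), and let $\mathcal{C}_u$ be the cyclic code of length $q+1$ over $\mathrm{GF}(q)$ with generator polynomial $g_u(x)$, i.e. the set of $(c_0,\dots,c_q)\in \mathrm{GF}(q)^{q+1}$ such that $\sum_i c_ix^i$ lies in the ideal generated by $g_u(x)$ in $\mathrm{GF}(q)[x]/(x^{q+1}-1)$. Let $$\overline{\mathcal{C}_u}=\Big\{(c_0,\dots,c_{q+1})\in\mathrm{GF}(q)^{q+2} : (c_0,\dots,c_q)\in\mathcal{C}_u,\ \sum_{i=0}^{q+1}c_i=0\Big\}$$ be its extended code, and let $\perp$ denote the Euclidean dual. An $[n,k,d]$ code over $\mathrm{GF}(q)$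 is a $k$-dimensional linear subspace of $\mathrm{GF}(q)^n$ with minimum Hamming distance $d$; it is MDS if $n,k\ge 1$ and $d=n-k+1$. A hyperoval code over $\mathrm{GF}(q)$ is a $[q+2,3,q]$ code. Then: 1. $\mathcal{C}_u$ is a $[q+1,q-1,3]$ MDS code over $\mathrm{GF}(q)$. 2. $(\mathcal{C}_u)^\perp$ is a $[q+1,2,q]$ MDS code over $\mathrm{GF}(q)$. 3. $\overline{\mathcal{C}_u}$ is a $[q+2,q-1,4]$ MDS code over $\mathrm{GF}(q)$. 4. $(\overline{\mathcal{C}_u})^\perp$ is a $[q+2,3,q]$ MDS code over $\mathrm{GF}(q)$, that is, an MDS hyperoval code. -/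

import Mathlib

open Polynomial

noncomputable section

/-- `C` is an `[n, k, d]` code over `F`: a `k`-dimensional linear subspace of `F ^ n` whose minimum
Hamming distance (the least distance between two distinct codewords) exists and equals `d`. -/
def IsLinearCode {F : Type*} [Field F] [DecidableEq F] (n k d : ℕ)
    (C : Submodule F (Fin n → F)) : Prop :=
  Module.finrank F C = k ∧
    IsLeast {t : ℕ | ∃ x ∈ C, ∃ y ∈ C, x ≠ y ∧ hammingDist x y = t} d

/-- An MDS code: an `[n, k, n - k + 1]` code with `n` and `k` positive. -/
def IsMDSCode {F : Type*} [Field F] [DecidableEq F] (n : ℕ)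
    (C : Submodule F (Fin n → F)) : Prop :=
  ∃ k d : ℕ, 0 < n ∧ 0 < k ∧ d + k = n + 1 ∧ IsLinearCode n k d C

/-- A hyperoval code over a field with `q` elements, `q = 2 ^ m`: a `[q + 2, 3, q]` code. -/
def IsHyperovalCode {F : Type*} [Field F] [DecidableEq F] (q : ℕ)
    (C : Submodule F (Fin (q + 2) → F)) : Prop :=
  Nat.card F = q ∧ (∃ m : ℕ, q = 2 ^ m) ∧ IsLinearCode (q + 2) 3 q C

/-- The (Euclidean) dual code. -/
def dualCode {F : Type*} [Field F] {n : ℕ} (C : Submodule F (Fin n → F)) :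
    Submodule F (Fin n → F) where
  carrier := {c | ∀ a ∈ C, a ⬝ᵥ c = 0}
  zero_mem' := fun a _ => dotProduct_zero a
  add_mem' := fun {x y} hx hy a ha => by
    rw [dotProduct_add, hx a ha, hy a ha, add_zero]
  smul_mem' := fun r x hx a ha => by
    rw [dotProduct_smul, hx a ha, smul_zero]

/-- The extended code: an overall parity check coordinate is appended, so that the coordinates of
every codeword sum to zero. -/
def extendedCode {F : Type*} [Field F] {n : ℕ} (C : Submodule F (Fin n → F)) :
    Submodule F (Fin (n + 1) → F) where
  carrier := {c | (fun i : Fin n => c i.castSucc) ∈ C ∧ ∑ i : Fin (n + 1), c i = 0}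
  zero_mem' := ⟨C.zero_mem, by simp⟩
  add_mem' := fun {x y} hx hy =>
    ⟨C.add_mem hx.1 hy.1, by
      simp only [Pi.add_apply, Finset.sum_add_distrib, hx.2, hy.2, add_zero]⟩
  smul_mem' := fun r x hx =>
    ⟨C.smul_mem r hx.1, by
      simp only [Pi.smul_apply, ← Finset.smul_sum, hx.2, smul_zero]⟩

/-- The polynomial `c₀ + c₁ x + ⋯ + c_{n-1} x ^ (n-1)` of a vector, as an `F`-linear map. -/
def codePoly (F : Type*) [Field F] (n : ℕ) : (Fin n → F) →ₗ[F] F[X] :=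
  ∑ i : Fin n, (Polynomial.monomial (i : ℕ)).comp (LinearMap.proj i)

/-- The cyclic code of length `n` generated by `g`: the vectors whose class in `F[x] / (x ^ n - 1)`
lies in the ideal generated by the class of `g`. -/
def cyclicCode {F : Type*} [Field F] (n : ℕ) (g : F[X]) : Submodule F (Fin n → F) :=
  ((Ideal.span {Ideal.Quotient.mk (Ideal.span {(X ^ n - 1 : F[X])}) g}).restrictScalars F).comap
    ((Ideal.Quotient.mkₐ F (Ideal.span {(X ^ n - 1 : F[X])})).toLinearMap.comp (codePoly F n))

/-- `g_u(x)`, the product of the minimal polynomials over `F` of `β ^ i`,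
for `u ≤ i ≤ ⌊(q + 1) / 2⌋`. -/
def genPoly (F : Type*) {K : Type*} [Field F] [Field K] [Algebra F K] (q u : ℕ) (β : K) : F[X] :=
  ∏ i ∈ Finset.Icc u ((q + 1) / 2), minpoly F (β ^ i)

/-- The code `C_u`: the cyclic code of length `q + 1` over `F` with generator polynomial `g_u`. -/
def codeC (F : Type*) {K : Type*} [Field F] [Field K] [Algebra F K] (q u : ℕ) (β : K) :
    Submodule F (Fin (q + 1) → F) :=
  cyclicCode (q + 1) (genPoly F q u β)

end

/-!
For `q = 2 * u` the generator polynomial is the minimal polynomial of `γ = β ^ u`, again a primitive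
`(q + 1)`-th root of unity. The Frobenius map `x ↦ x ^ q` inverts `γ`, so the polynomial of a
codeword vanishes at both `γ⁻¹` and `γ`. These are consecutive in the progression of ratio `γ ^ 2`,
which is a primitive root because `q + 1` is odd, so the BCH bound gives weight at least `3`. If the
coordinates moreover sum to zero then `1` is a root as well, and the three consecutive powers `γ⁻¹`,
`1`, `γ` give weight at least `4`. Since the generator has degree at most `2`, the Singleton bound
leaves no room: the code and its extension are MDS, and hence so are their duals.
-/

section LinearCode

lemma hammingNorm_add_card_le {ι R : Type*} [Fintype ι] [Zero R] [DecidableEq R] {x : ι → R}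
    {s : Finset ι} (hs : ∀ i ∈ s, x i = 0) : hammingNorm x + s.card ≤ Fintype.card ι := by
  classical
  have hdisj : Disjoint (Finset.univ.filter fun i => x i ≠ 0) s :=
    Finset.disjoint_left.mpr fun i hi his => (Finset.mem_filter.mp hi).2 (hs i his)
  rw [hammingNorm, ← Finset.card_union_of_disjoint hdisj]
  exact Finset.card_le_univ _

lemma exists_mem_ne_zero_forall_eq_zero {ι F : Type*} [Finite ι] [Field F]
    {C : Submodule F (ι → F)} {s : Finset ι} (hs : s.card < Module.finrank F C) :
    ∃ x ∈ C, x ≠ 0 ∧ ∀ i ∈ s, x i = 0 := by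
  have hker : LinearMap.ker ((LinearMap.funLeft F F ((↑) : s → ι)).domRestrict C) ≠ ⊥ :=
    LinearMap.ker_ne_bot_of_finrank_lt (by simpa using hs)
  obtain ⟨⟨x, hxC⟩, hx, hx0⟩ := (Submodule.ne_bot_iff _).mp hker
  exact ⟨x, hxC, by simpa using hx0, fun i hi => congrFun (LinearMap.mem_ker.mp hx) ⟨i, hi⟩⟩

variable {F : Type*} [Field F] {n : ℕ}

lemma finrank_add_finrank_dualCode (C : Submodule F (Fin n → F)) :
    Module.finrank F C + Module.finrank F (dualCode C) = n := by
  have hdual : (dualCode C).map (dotProductEquiv F (Fin n)).toLinearMap = C.dualAnnihilator := by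
    ext φ
    obtain ⟨c, rfl⟩ := (dotProductEquiv F (Fin n)).surjective φ
    simp [Submodule.mem_dualAnnihilator, dualCode, dotProduct_comm c]
  rw [← LinearEquiv.finrank_map_eq (dotProductEquiv F (Fin n)) (dualCode C), hdual,
    Subspace.finrank_add_finrank_dualAnnihilator_eq, Module.finrank_fin_fun]

variable [DecidableEq F]

lemma singleton_bound {C : Submodule F (Fin n → F)} (hC : 0 < Module.finrank F C) :
    ∃ x ∈ C, x ≠ 0 ∧ hammingNorm x + Module.finrank F C ≤ n + 1 := by
  have hle : Module.finrank F C - 1 ≤ (Finset.univ : Finset (Fin n)).card := by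
    rw [Finset.card_fin]
    exact (Nat.sub_le _ _).trans ((Submodule.finrank_le C).trans_eq (Module.finrank_fin_fun F))
  obtain ⟨s, -, hs⟩ := Finset.exists_subset_card_eq hle
  obtain ⟨x, hx, hx0, hxs⟩ := exists_mem_ne_zero_forall_eq_zero (C := C) (s := s) (by omega)
  have hnorm := hammingNorm_add_card_le hxs
  rw [Fintype.card_fin] at hnorm
  exact ⟨x, hx, hx0, by omega⟩

variable {C : Submodule F (Fin n → F)} {k d : ℕ}

lemma isLinearCode_of_forall_le_hammingNorm (hk : 0 < k) (hkd : d + k = n + 1)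
    (hdim : k ≤ Module.finrank F C) (hd : ∀ x ∈ C, x ≠ 0 → d ≤ hammingNorm x) :
    IsLinearCode n k d C := by
  obtain ⟨x, hx, hx0, hle⟩ := singleton_bound (hk.trans_le hdim)
  have hdx := hd x hx hx0
  refine ⟨by omega, ⟨x, hx, 0, C.zero_mem, hx0, ?_⟩, ?_⟩
  · rw [hammingDist_zero_right]
    omega
  · rintro t ⟨y, hy, z, hz, hyz, rfl⟩
    rw [hammingDist_comm, hammingDist_eq_hammingNorm, neg_add_eq_sub]
    exact hd _ (C.sub_mem hy hz) (sub_ne_zero.mpr hyz)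

namespace IsLinearCode

lemma le_hammingNorm (hC : IsLinearCode n k d C) {x : Fin n → F} (hx : x ∈ C) (hx0 : x ≠ 0) :
    d ≤ hammingNorm x :=
  hC.2.2 ⟨x, hx, 0, C.zero_mem, hx0, hammingDist_zero_right x⟩

lemma add_finrank_dualCode (hC : IsLinearCode n k d C) :
    k + Module.finrank F (dualCode C) = n :=
  hC.1 ▸ finrank_add_finrank_dualCode C

lemma isMDSCode (hC : IsLinearCode n k d C) (hk : 0 < k) (hkd : d + k = n + 1) :
    IsMDSCode n C := by
  have hdim := hC.add_finrank_dualCode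
  exact ⟨k, d, by omega, hk, hkd, hC⟩

lemma lt_hammingNorm_of_mem_dualCode (hC : IsLinearCode n k d C) (hkd : d + k = n + 1)
    {c : Fin n → F} (hc : c ∈ dualCode C) (hc0 : c ≠ 0) : k < hammingNorm c := by
  by_contra! hle
  obtain ⟨i, hi⟩ := Function.ne_iff.mp hc0
  have hkn : k ≤ (Finset.univ : Finset (Fin n)).card := by
    rw [Finset.card_fin]
    exact hC.add_finrank_dualCode ▸ Nat.le_add_right _ _
  obtain ⟨t, hct, -, ht⟩ := Finset.exists_subsuperset_card_eq (Finset.subset_univ _) hle hkn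
  have hsupp : ∀ j, j ∉ t → c j = 0 := fun j hj => by
    by_contra hcj
    exact hj (hct (by simpa using hcj))
  have hit : i ∈ t := by
    by_contra h
    exact hi (hsupp i h)
  obtain ⟨x, hx, hx0, hxt⟩ := exists_mem_ne_zero_forall_eq_zero (C := C) (s := t.erase i) <| by
    rw [hC.1, ← ht]
    exact Finset.card_erase_lt_of_mem hit
  -- `x` meets the support of `c` at most in `i`, so orthogonality kills that coordinate too.
  have hxc : x i * c i = 0 := by
    refine (Fintype.sum_eq_single i fun j hji => ?_).symm.trans (hc x hx)
    by_cases hj : j ∈ t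
    · rw [hxt j (Finset.mem_erase.mpr ⟨hji, hj⟩), zero_mul]
    · rw [hsupp j hj, mul_zero]
  have hxi : x i = 0 := (mul_eq_zero.mp hxc).resolve_right hi
  have hnorm := hammingNorm_add_card_le (x := x) (s := t) fun j hj => by
    by_cases hji : j = i
    · rw [hji, hxi]
    · exact hxt j (Finset.mem_erase.mpr ⟨hji, hj⟩)
  have hdist := hC.le_hammingNorm hx hx0
  rw [Fintype.card_fin] at hnorm
  omega

lemma dual (hC : IsLinearCode n k d C) (hkd : d + k = n + 1) {k' d' : ℕ} (hk' : 0 < k')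
    (hkk' : k + k' = n) (hkd' : d' + k' = n + 1) : IsLinearCode n k' d' (dualCode C) := by
  have hdim := hC.add_finrank_dualCode
  refine isLinearCode_of_forall_le_hammingNorm hk' hkd' (by omega) fun c hc hc0 => ?_
  have hnorm := hC.lt_hammingNorm_of_mem_dualCode hkd hc hc0
  omega

end IsLinearCode

end LinearCode

section ExtendedCode

variable {F : Type*} [Field F] {n : ℕ}

lemma finrank_le_finrank_extendedCode (C : Submodule F (Fin n → F)) :
    Module.finrank F C ≤ Module.finrank F (extendedCode C) := by
  have hle : C ≤ (extendedCode C).map (LinearMap.funLeft F F Fin.castSucc) := fun x hx =>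
    ⟨Fin.snoc x (-∑ i, x i), ⟨by simpa using hx, by simp [Fin.sum_univ_castSucc]⟩,
      funext fun i => by simp [LinearMap.funLeft_apply]⟩
  exact (Submodule.finrank_mono hle).trans (Submodule.finrank_map_le _ _)

lemma hammingNorm_eq_castSucc_add_last {R : Type*} [Zero R] [DecidableEq R]
    (c : Fin (n + 1) → R) :
    hammingNorm c = hammingNorm (fun i : Fin n => c i.castSucc) +
      if c (Fin.last n) = 0 then 0 else 1 := by
  simp only [hammingNorm, Finset.card_filter, Fin.sum_univ_castSucc, ne_eq, ite_not]

lemma lt_hammingNorm_of_mem_extendedCode [DecidableEq F] {C : Submodule F (Fin n → F)} {d : ℕ}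
    (hd : ∀ x ∈ C, x ≠ 0 → d ≤ hammingNorm x)
    (hd0 : ∀ x ∈ C, x ≠ 0 → ∑ i, x i = 0 → d < hammingNorm x)
    {c : Fin (n + 1) → F} (hc : c ∈ extendedCode C) (hc0 : c ≠ 0) : d < hammingNorm c := by
  obtain ⟨hcC, hsum⟩ := hc
  rw [Fin.sum_univ_castSucc] at hsum
  have hinit : (fun i : Fin n => c i.castSucc) ≠ 0 := fun h => by
    have h' : ∀ i : Fin n, c i.castSucc = 0 := congrFun h
    refine hc0 (funext fun i => Fin.lastCases ?_ h' i)
    simpa [h'] using hsum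
  rw [hammingNorm_eq_castSucc_add_last]
  split_ifs with hlast
  · exact hd0 _ hcC hinit (by simpa [hlast] using hsum)
  · exact Nat.lt_succ_of_le (hd _ hcC hinit)

end ExtendedCode

section CyclicCode

variable {F : Type*} [Field F] {n : ℕ}

lemma mem_cyclicCode_of_dvd {g : F[X]} {c : Fin n → F} (h : g ∣ codePoly F n c) :
    c ∈ cyclicCode n g :=
  Ideal.mem_span_singleton.mpr (map_dvd (Ideal.Quotient.mk _) h)

lemma dvd_codePoly_of_mem_cyclicCode {g : F[X]} (hg : g ∣ X ^ n - 1) {c : Fin n → F}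
    (hc : c ∈ cyclicCode n g) : g ∣ codePoly F n c := by
  obtain ⟨b, hb⟩ := Ideal.mem_span_singleton.mp hc
  obtain ⟨b, rfl⟩ := Ideal.Quotient.mk_surjective b
  have hmod : X ^ n - 1 ∣ codePoly F n c - g * b := by
    rwa [← Ideal.mem_span_singleton, ← Ideal.Quotient.mk_eq_mk_iff_sub_mem, map_mul]
  exact (dvd_sub_left (dvd_mul_right g b)).mp (hg.trans hmod)

lemma le_finrank_cyclicCode_add_natDegree {g : F[X]} (hg : g ≠ 0) :
    n ≤ Module.finrank F (cyclicCode n g) + g.natDegree := by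
  have : FiniteDimensional F (F[X] ⧸ Ideal.span {g}) := (AdjoinRoot.powerBasis hg).finite
  let residue : (Fin n → F) →ₗ[F] F[X] ⧸ Ideal.span {g} :=
    (Ideal.Quotient.mkₐ F (Ideal.span {g})).toLinearMap.comp (codePoly F n)
  have hker : LinearMap.ker residue ≤ cyclicCode n g := fun c hc =>
    mem_cyclicCode_of_dvd (Ideal.mem_span_singleton.mp (Ideal.Quotient.eq_zero_iff_mem.mp hc))
  calc n = Module.finrank F (LinearMap.range residue) + Module.finrank F (LinearMap.ker residue) :=
        by rw [LinearMap.finrank_range_add_finrank_ker, Module.finrank_fin_fun]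
    _ ≤ g.natDegree + Module.finrank F (cyclicCode n g) :=
        add_le_add ((Submodule.finrank_le _).trans_eq finrank_quotient_span_eq_natDegree)
          (Submodule.finrank_mono hker)
    _ = _ := add_comm _ _

lemma aeval_codePoly {A : Type*} [CommSemiring A] [Algebra F A] (c : Fin n → F) (x : A) :
    aeval x (codePoly F n c) = ∑ i : Fin n, algebraMap F A (c i) * x ^ (i : ℕ) := by
  simp [codePoly, LinearMap.sum_apply, aeval_monomial]

variable {K : Type*} [Field K] [Algebra F K]

lemma aeval_codePoly_eq_zero_of_mem_cyclicCode {γ : K} (hγ : γ ^ n = 1) {c : Fin n → F}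
    (hc : c ∈ cyclicCode n (minpoly F γ)) : aeval γ (codePoly F n c) = 0 :=
  minpoly.dvd_iff.mp (dvd_codePoly_of_mem_cyclicCode (minpoly.dvd F γ (by simp [hγ])) hc)

lemma codeC_eq_cyclicCode_minpoly {q u : ℕ} (hu : q = 2 * u) (β : K) :
    codeC F q u β = cyclicCode (q + 1) (minpoly F (β ^ u)) := by
  have hhalf : (q + 1) / 2 = u := by omega
  rw [codeC, genPoly, hhalf, Finset.Icc_self, Finset.prod_singleton]

end CyclicCode

section BCH

lemma lt_hammingNorm_of_forall_sum_mul_pow_eq_zero {ι R : Type*} [Fintype ι] [CommRing R]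
    [IsDomain R] [DecidableEq R] {v y : ι → R} (hy : Function.Injective y) (hv : v ≠ 0) {r : ℕ}
    (h : ∀ j < r, ∑ i, v i * y i ^ j = 0) : r < hammingNorm v := by
  classical
  by_contra! hle
  obtain ⟨i, hi⟩ := Function.ne_iff.mp hv
  set s : Finset ι := {k | v k ≠ 0} with hs
  have his : i ∈ s := by simpa [hs] using hi
  let p := Lagrange.nodal (s.erase i) y
  have hdeg : p.natDegree < r := by
    rw [Lagrange.natDegree_nodal]
    exact (Finset.card_erase_lt_of_mem his).trans_le hle
  have hzero : ∑ k, v k * p.eval (y k) = 0 := by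
    simp_rw [eval_eq_sum_range' hdeg, Finset.mul_sum]
    rw [Finset.sum_comm]
    refine Finset.sum_eq_zero fun j hj => ?_
    simp_rw [mul_left_comm (v _), ← Finset.mul_sum]
    rw [h j (Finset.mem_range.mp hj), mul_zero]
  have hsingle : ∑ k, v k * p.eval (y k) = v i * p.eval (y i) := by
    refine Fintype.sum_eq_single i fun k hki => ?_
    by_cases hk : k ∈ s
    · rw [Lagrange.eval_nodal_at_node (Finset.mem_erase.mpr ⟨hki, hk⟩), mul_zero]
    · rw [show v k = 0 by simpa [hs] using hk, zero_mul]
  refine mul_ne_zero hi (Lagrange.eval_nodal_not_at_node fun k hk => ?_) (hsingle ▸ hzero)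
  exact hy.ne (Finset.ne_of_mem_erase hk).symm

variable {F K : Type*} [Field F] [DecidableEq F] [Field K] [Algebra F K]

lemma bch_bound {n r : ℕ} {δ ζ : K} (hδ : δ ≠ 0) (hζ : IsPrimitiveRoot ζ n) {c : Fin n → F}
    (hc : c ≠ 0) (h : ∀ j < r, aeval (δ * ζ ^ j) (codePoly F n c) = 0) : r < hammingNorm c := by
  classical
  have hinj : ∀ i : Fin n, Function.Injective fun a : F => algebraMap F K a * δ ^ (i : ℕ) :=
    fun i => (mul_left_injective₀ (pow_ne_zero _ hδ)).comp (algebraMap F K).injective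
  have hnorm := hammingNorm_comp _ (x := c) hinj (by simp)
  have hpow : Function.Injective fun i : Fin n => ζ ^ (i : ℕ) := fun i j hij =>
    Fin.ext (hζ.pow_inj i.2 j.2 hij)
  rw [← hnorm]
  refine lt_hammingNorm_of_forall_sum_mul_pow_eq_zero hpow ?_ fun j hj => ?_
  · rwa [← hammingNorm_ne_zero_iff, hnorm, hammingNorm_ne_zero_iff]
  · rw [← h j hj, aeval_codePoly]
    refine Finset.sum_congr rfl fun i _ => ?_
    rw [mul_pow, mul_assoc, ← pow_mul, ← pow_mul, mul_comm j]

end BCH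

section UnitCircle

variable {F : Type*} [Field F] [Finite F]

lemma aeval_pow_natCard {A : Type*} [CommSemiring A] [Algebra F A] (f : F[X]) (x : A) :
    aeval (x ^ Nat.card F) f = aeval x f ^ Nat.card F := by
  have := Fintype.ofFinite F
  rw [Nat.card_eq_fintype_card, ← expand_aeval, FiniteField.expand_card, map_pow]

variable {K : Type*} [Field K] [Algebra F K] {γ : K}

lemma natDegree_minpoly_le_two (hγ : γ ^ (Nat.card F + 1) = 1) :
    (minpoly F γ).natDegree ≤ 2 := by
  have hroot : γ ^ Nat.card F ^ 2 = γ := by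
    have hexp : Nat.card F ^ 2 = (Nat.card F + 1) * (Nat.card F - 1) + 1 := by
      zify [Nat.card_pos (α := F)]
      ring
    rw [hexp, pow_succ, pow_mul, hγ, one_pow, one_mul]
  have hint : IsIntegral F γ := .of_pow (Nat.succ_pos _) (hγ ▸ isIntegral_one)
  have hdvd : minpoly F γ ∣ X ^ Nat.card F ^ 2 - X := minpoly.dvd F γ (by simp [hroot])
  exact Nat.le_of_dvd two_pos
    ((minpoly.irreducible hint).natDegree_dvd_of_dvd_X_pow_card_pow_sub_X hdvd)

lemma le_finrank_cyclicCode_minpoly (hγ : γ ^ (Nat.card F + 1) = 1) :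
    Nat.card F - 1 ≤ Module.finrank F (cyclicCode (Nat.card F + 1) (minpoly F γ)) := by
  have hint : IsIntegral F γ := .of_pow (Nat.succ_pos _) (hγ ▸ isIntegral_one)
  have hcodim := le_finrank_cyclicCode_add_natDegree (n := Nat.card F + 1) (minpoly.ne_zero hint)
  have hdeg := natDegree_minpoly_le_two hγ
  omega

lemma aeval_inv_eq_zero (hγ : γ ^ (Nat.card F + 1) = 1) {f : F[X]} (hf : aeval γ f = 0) :
    aeval γ⁻¹ f = 0 := by
  have hinv : γ⁻¹ = γ ^ Nat.card F := inv_eq_of_mul_eq_one_right (by rw [← pow_succ', hγ])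
  rw [hinv, aeval_pow_natCard, hf, zero_pow Nat.card_pos.ne']

variable [DecidableEq F]

lemma three_le_hammingNorm_of_mem_cyclicCode_minpoly (hF : Even (Nat.card F))
    (hγ : IsPrimitiveRoot γ (Nat.card F + 1)) {c : Fin (Nat.card F + 1) → F}
    (hc : c ∈ cyclicCode _ (minpoly F γ)) (hc0 : c ≠ 0) : 3 ≤ hammingNorm c := by
  have hγ0 : γ ≠ 0 := hγ.ne_zero (Nat.succ_ne_zero _)
  have hγ2 : IsPrimitiveRoot (γ ^ 2) (Nat.card F + 1) :=
    hγ.pow_of_coprime 2 (Nat.coprime_two_left.mpr hF.add_one)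
  have hzero := aeval_codePoly_eq_zero_of_mem_cyclicCode hγ.pow_eq_one hc
  have hzero_inv := aeval_inv_eq_zero hγ.pow_eq_one hzero
  refine bch_bound (r := 2) (inv_ne_zero hγ0) hγ2 hc0 fun j hj => ?_
  interval_cases j
  · simpa using hzero_inv
  · simpa [pow_two, hγ0] using hzero

lemma four_le_hammingNorm_of_mem_cyclicCode_minpoly
    (hγ : IsPrimitiveRoot γ (Nat.card F + 1)) {c : Fin (Nat.card F + 1) → F}
    (hc : c ∈ cyclicCode _ (minpoly F γ)) (hc0 : c ≠ 0) (hsum : ∑ i, c i = 0) :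
    4 ≤ hammingNorm c := by
  have hγ0 : γ ≠ 0 := hγ.ne_zero (Nat.succ_ne_zero _)
  have hzero := aeval_codePoly_eq_zero_of_mem_cyclicCode hγ.pow_eq_one hc
  have hzero_inv := aeval_inv_eq_zero hγ.pow_eq_one hzero
  have hzero_one : aeval (1 : K) (codePoly F _ c) = 0 := by
    simp [aeval_codePoly, ← map_sum, hsum]
  refine bch_bound (r := 3) (inv_ne_zero hγ0) hγ hc0 fun j hj => ?_
  interval_cases j
  · simpa using hzero_inv
  · simpa [hγ0] using hzero_one
  · simpa [pow_two, hγ0] using hzero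

lemma isLinearCode_cyclicCode_minpoly (hF : Even (Nat.card F))
    (hγ : IsPrimitiveRoot γ (Nat.card F + 1)) :
    IsLinearCode (Nat.card F + 1) (Nat.card F - 1) 3
      (cyclicCode (Nat.card F + 1) (minpoly F γ)) := by
  have hcard : 1 < Nat.card F := Finite.one_lt_card
  exact isLinearCode_of_forall_le_hammingNorm (by omega) (by omega)
    (le_finrank_cyclicCode_minpoly hγ.pow_eq_one)
    fun _ => three_le_hammingNorm_of_mem_cyclicCode_minpoly hF hγ

lemma isLinearCode_extendedCode_cyclicCode_minpoly (hF : Even (Nat.card F))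
    (hγ : IsPrimitiveRoot γ (Nat.card F + 1)) :
    IsLinearCode (Nat.card F + 2) (Nat.card F - 1) 4
      (extendedCode (cyclicCode (Nat.card F + 1) (minpoly F γ))) := by
  have hcard : 1 < Nat.card F := Finite.one_lt_card
  exact isLinearCode_of_forall_le_hammingNorm (by omega) (by omega)
    ((le_finrank_cyclicCode_minpoly hγ.pow_eq_one).trans (finrank_le_finrank_extendedCode _))
    fun _ => lt_hammingNorm_of_mem_extendedCode
      (fun _ => three_le_hammingNorm_of_mem_cyclicCode_minpoly hF hγ)
      (fun _ => four_le_hammingNorm_of_mem_cyclicCode_minpoly hγ)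

end UnitCircle

section EvenOrderField

variable {F K : Type*} [Field F] [Finite F] [Field K] [Algebra F K]

lemma exists_natCard_eq_two_pow (hF : Even (Nat.card F)) : ∃ m : ℕ, Nat.card F = 2 ^ m := by
  have := Fintype.ofFinite F
  obtain ⟨p, -, k, hp, hcard⟩ := FiniteField.card' F
  rw [Nat.card_eq_fintype_card, hcard] at hF ⊢
  have h2 : 2 = p := (Nat.prime_dvd_prime_iff_eq Nat.prime_two hp).mp
    (Nat.prime_two.dvd_of_dvd_pow hF.two_dvd)
  exact ⟨k, by rw [h2]⟩

lemma isPrimitiveRoot_pow_natCard_sub_one (hK : Module.finrank F K = 2) {α : Kˣ}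
    (hα : ∀ x : Kˣ, x ∈ Subgroup.zpowers α) :
    IsPrimitiveRoot ((α : K) ^ (Nat.card F - 1)) (Nat.card F + 1) := by
  have : FiniteDimensional F K := Module.finite_of_finrank_eq_succ hK
  have : Finite K := Module.finite_of_finite F
  have horder : orderOf α = (Nat.card F - 1) * (Nat.card F + 1) := by
    rw [orderOf_eq_card_of_forall_mem_zpowers hα, Nat.card_units,
      Module.natCard_eq_pow_finrank (K := F), hK, mul_comm, ← Nat.sq_sub_sq, one_pow]
  have hprim : IsPrimitiveRoot (α : K) (orderOf α) :=
    IsPrimitiveRoot.coe_units_iff.mpr (IsPrimitiveRoot.orderOf α)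
  exact hprim.pow (orderOf_pos α) horder

end EvenOrderField

theorem mainTheorem12_general {F K : Type*} [Field F] [Finite F] [DecidableEq F] [Field K]
    [Algebra F K] {q u : ℕ} (hF : Nat.card F = q) (hu : q = 2 * u) {β : K}
    (hβ : IsPrimitiveRoot β (q + 1)) :
    (IsLinearCode (q + 1) (q - 1) 3 (codeC F q u β) ∧
      IsMDSCode (q + 1) (codeC F q u β)) ∧
    (IsLinearCode (q + 1) 2 q (dualCode (codeC F q u β)) ∧
      IsMDSCode (q + 1) (dualCode (codeC F q u β))) ∧
    (IsLinearCode (q + 2) (q - 1) 4 (extendedCode (codeC F q u β)) ∧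
      IsMDSCode (q + 2) (extendedCode (codeC F q u β))) ∧
    (IsLinearCode (q + 2) 3 q (dualCode (extendedCode (codeC F q u β))) ∧
      IsMDSCode (q + 2) (dualCode (extendedCode (codeC F q u β))) ∧
      IsHyperovalCode q (dualCode (extendedCode (codeC F q u β)))) := by
  subst hF
  have hcard : 1 < Nat.card F := Finite.one_lt_card
  have heven : Even (Nat.card F) := hu ▸ even_two_mul u
  have hcoprime : u.Coprime (Nat.card F + 1) := by simp [hu]
  have hγ : IsPrimitiveRoot (β ^ u) (Nat.card F + 1) := hβ.pow_of_coprime u hcoprime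
  rw [codeC_eq_cyclicCode_minpoly hu]
  have hcode := isLinearCode_cyclicCode_minpoly heven hγ
  have hext := isLinearCode_extendedCode_cyclicCode_minpoly heven hγ
  have hdual := hcode.dual (k' := 2) (d' := Nat.card F) (by omega) (by omega) (by omega) (by omega)
  have hhyperoval := hext.dual (k' := 3) (d' := Nat.card F)
    (by omega) (by omega) (by omega) (by omega)
  exact ⟨⟨hcode, hcode.isMDSCode (by omega) (by omega)⟩,
    ⟨hdual, hdual.isMDSCode (by omega) (by omega)⟩,
    ⟨hext, hext.isMDSCode (by omega) (by omega)⟩,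
    hhyperoval, hhyperoval.isMDSCode (by omega) (by omega),
    rfl, exists_natCard_eq_two_pow heven, hhyperoval⟩

theorem mainTheorem12 {F K : Type*} [Field F] [Finite F] [DecidableEq F] [Field K] [Algebra F K]
    (m q u : ℕ) (hm : 2 ≤ m) (hq : q = 2 ^ m) (hu : u = 2 ^ (m - 1))
    (hF : Nat.card F = q) (hK : Module.finrank F K = 2)
    (α : Kˣ) (hα : ∀ x : Kˣ, x ∈ Subgroup.zpowers α)
    (β : K) (hβ : β = (α : K) ^ (q - 1)) :
    (IsLinearCode (q + 1) (q - 1) 3 (codeC F q u β) ∧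
      IsMDSCode (q + 1) (codeC F q u β)) ∧
    (IsLinearCode (q + 1) 2 q (dualCode (codeC F q u β)) ∧
      IsMDSCode (q + 1) (dualCode (codeC F q u β))) ∧
    (IsLinearCode (q + 2) (q - 1) 4 (extendedCode (codeC F q u β)) ∧
      IsMDSCode (q + 2) (extendedCode (codeC F q u β))) ∧
    (IsLinearCode (q + 2) 3 q (dualCode (extendedCode (codeC F q u β))) ∧
      IsMDSCode (q + 2) (dualCode (extendedCode (codeC F q u β))) ∧
      IsHyperovalCode q (dualCode (extendedCode (codeC F q u β)))) := by
  subst hβ hF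
  exact mainTheorem12_general rfl (by rw [hq, hu, mul_pow_sub_one (by omega)])
    (isPrimitiveRoot_pow_natCard_sub_one hK hα)
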